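/- For a finite poset $P$, let $|P|$ denote the compact polyhedron in $\mathbb R^P$ formed by all $x$ with $x_p\ge 0$, $\sum_p x_p=1$ whose support $\{p: x_p\neq 0\}$ is a chain (the geometric realization of the order complex of $P$). For a subset $S\subset P$ with the induced order, $|S|$ is regarded as the subset of $|P|$ consisting of the points supported in $S$. For $p\in P$ let $\lfloor p\rfloor=\{q\in P: q\le p\}$ and $\partial\lfloor p\rfloor=\{q\in P: q<p\}$. Let $CQ$ denote the cone over a poset $Q$, obtained by adjoining to $Q$ a new greatest element; $|Q|$ is regarded as a subset of $|CQ|$. A map between compact polyhedra $X$ and $Y$ is piecewise linear (PL) if $X$ is a finite union of compact sets, each given by finitely many affine inequalities, on each of which the map is affine; a PL homeomorphism is a homeomorphism which is PL together with its inverse. A monotone map $f\colon P'\to P$ of finite posets is called a subdivision map if for each $p\in P$ there is a PL homeomorphism $|f^{-1}(\lfloor p\rfloor)|\to|Cf^{-1}(\partial\lfloor p\rfloor)|$ that is the identity on $|f^{-1}(\partial\lfloor p\rfloor)|$. **Theorem.** A monotone map $f\colon P'\to P$ of finite posets is a subdivision map if and only if there exists a PL homeomorphism $h\colon|P'|\to|P|$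 such that $h^{-1}(|\lfloor p\rfloor|)=|f^{-1}(\lfloor p\rfloor)|$ for each $p\in P$. -/

import Mathlib

namespace PLPoset

/-- The polyhedron `|S|` of a subposet `S` of a finite poset `P`: the union, inside the standard
simplex with vertex set `P`, of the simplices spanned by the nonempty chains of `S`.
In particular `|P|` is `realization Set.univ`. -/
def realization {P : Type*} [Fintype P] [PartialOrder P] (S : Set P) : Set (P → ℝ) :=
  {x | (∀ p, 0 ≤ x p) ∧ ∑ p, x p = 1 ∧
    {p | x p ≠ 0} ⊆ S ∧ IsChain (· ≤ ·) {p | x p ≠ 0}}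

/-- A convex linear cell in `ℝ^ι`: a compact set given by finitely many affine inequalities. -/
def IsCell {ι : Type*} (C : Set (ι → ℝ)) : Prop :=
  IsCompact C ∧ ∃ L : Set ((ι → ℝ) →ᵃ[ℝ] ℝ), L.Finite ∧ C = {x | ∀ l ∈ L, 0 ≤ l x}

/-- A piecewise linear map between compact polyhedra: `X` is a finite union of convex linear
cells on each of which the map is affine. -/
def IsPL {ι κ : Type*} {X : Set (ι → ℝ)} {Y : Set (κ → ℝ)} (f : X → Y) : Prop :=
  ∃ K : Set (Set (ι → ℝ)), K.Finite ∧ (∀ C ∈ K, IsCell C) ∧ ⋃₀ K = X ∧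
    ∀ C ∈ K, ∃ a : (ι → ℝ) →ᵃ[ℝ] (κ → ℝ), ∀ x : X, (x : ι → ℝ) ∈ C → (f x : κ → ℝ) = a x

/-- A piecewise linear homeomorphism. -/
def IsPLHomeo {ι κ : Type*} {X : Set (ι → ℝ)} {Y : Set (κ → ℝ)} (h : X ≃ₜ Y) : Prop :=
  IsPL h ∧ IsPL h.symm

/-- The cone `CQ` over a subposet `Q` of `P`: a new greatest element is adjoined to `Q`.
It is regarded as a subposet of `WithTop P`. -/
def cone {P : Type*} (Q : Set P) : Set (WithTop P) :=
  insert ⊤ ((fun q : P => (q : WithTop P)) '' Q)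

/-- Extension by zero at `⊤`: for `Q` a subposet of `P`, it restricts to the standard inclusion
of `|Q|` into `|CQ|`. -/
def toCone {P : Type*} (x : P → ℝ) : WithTop P → ℝ :=
  fun q => WithTop.recTopCoe (C := fun _ => ℝ) 0 x q

/-- A monotone map `f : P' → P` is a subdivision map if, for each `p`, there is a
PL homeomorphism of `|f⁻¹(⌊p⌋)|` onto `|C f⁻¹(∂⌊p⌋)|` that is fixed on `|f⁻¹(∂⌊p⌋)|`. Here
`⌊p⌋ = Iic p`, and its boundary `∂⌊p⌋`, whose cone is `⌊p⌋`, is `Iio p`. -/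
def IsSubdivisionMap {P' P : Type*} [Fintype P'] [PartialOrder P'] [PartialOrder P]
    (f : P' → P) : Prop :=
  Monotone f ∧ ∀ p : P,
    ∃ g : realization (f ⁻¹' Set.Iic p) ≃ₜ realization (cone (f ⁻¹' Set.Iio p)),
      IsPLHomeo g ∧
        ∀ x : realization (f ⁻¹' Set.Iic p), (x : P' → ℝ) ∈ realization (f ⁻¹' Set.Iio p) →
          (g x : WithTop P' → ℝ) = toCone (x : P' → ℝ)

end PLPoset

/-!
For a lower set `T` of `P` the realization `|T|` is the union of the `|Iic q|`, `q ∈ T`, and `|Iic p|`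
is linearly isomorphic to the cone over `|Iio p|` (`isPLEquivOn_toConeAt`). A PL homeomorphism between
the bases of two cones extends radially to the cones (`IsPLEquivOn.cone`): on the cone over a cell
on which the map is `y ↦ A y + b` the extension is the linear map
`((1 - t) y, t) ↦ (A ((1 - t) y) + (1 - t) b, t)`.

If `h : |P'| ≃ |P|` respects the subcomplexes `|Iic q|`, then it restricts to PL homeomorphisms
`|f⁻¹ (Iic p)| ≃ |Iic p|` and `|f⁻¹ (Iio p)| ≃ |Iio p|`. The first one, followed by the radial
extension of the inverse of the second one, is fixed on `|f⁻¹ (Iio p)|`.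

Conversely, `h` is built one element of `P` at a time (`exists_isPLEquivOn_of_isLowerSet`). If it is
known over a lower set `S` and `p` is a minimal element outside `S`, then the given homeomorphism
`|f⁻¹ (Iic p)| ≃ |C f⁻¹ (Iio p)|` followed by the radial extension of `h` defines it over `Iic p`.
The two agree on `|f⁻¹ (Iio p)| = |f⁻¹ S| ∩ |f⁻¹ (Iic p)|` since the given homeomorphism is fixed
there, so they glue (`IsPLEquivOn.union`).
-/

namespace PLPoset

open Set

/-! ### Cells and polyhedra -/

section PL

variable {ι κ μ : Type*}

/-- Normed structures on `ι → ℝ` need `Fintype ι`; continuity of affine maps does not. -/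
theorem continuous_affineMap [Finite ι] (a : (ι → ℝ) →ᵃ[ℝ] (κ → ℝ)) : Continuous a := by
  rw [AffineMap.decomp a]
  exact a.linear.continuous_on_pi.add continuous_const

/-- Pulling a cell back along an affine map and cutting it out of a cell gives a cell. -/
theorem IsCell.inter_preimage [Finite ι] {C : Set (ι → ℝ)} {D : Set (κ → ℝ)}
    (hC : IsCell C) (hD : IsCell D) (a : (ι → ℝ) →ᵃ[ℝ] (κ → ℝ)) : IsCell (C ∩ a ⁻¹' D) := by
  obtain ⟨hCc, L, hL, hCL⟩ := hC
  obtain ⟨hDc, M, hM, hDM⟩ := hD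
  refine ⟨hCc.inter_right (hDc.isClosed.preimage (continuous_affineMap a)),
    L ∪ (fun l => l.comp a) '' M, hL.union (hM.image _), ?_⟩
  ext x
  rw [hCL, hDM]
  simp [or_imp, forall_and]

theorem IsCell.inter [Finite ι] {C D : Set (ι → ℝ)} (hC : IsCell C) (hD : IsCell D) :
    IsCell (C ∩ D) :=
  hC.inter_preimage hD (AffineMap.id ℝ _)

/-- A polyhedron: a finite union of cells. -/
def IsPolyhedron (X : Set (ι → ℝ)) : Prop :=
  ∃ K : Set (Set (ι → ℝ)), K.Finite ∧ (∀ C ∈ K, IsCell C) ∧ ⋃₀ K = X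

/-- Piecewise linearity on `X` of a map defined on the whole ambient space. -/
def IsPLOn (F : (ι → ℝ) → (κ → ℝ)) (X : Set (ι → ℝ)) : Prop :=
  ∃ K : Set (Set (ι → ℝ)), K.Finite ∧ (∀ C ∈ K, IsCell C) ∧ ⋃₀ K = X ∧
    ∀ C ∈ K, ∃ a : (ι → ℝ) →ᵃ[ℝ] (κ → ℝ), EqOn F a C

theorem IsPolyhedron.isPLOn_affine {X : Set (ι → ℝ)} (hX : IsPolyhedron X)
    (a : (ι → ℝ) →ᵃ[ℝ] (κ → ℝ)) : IsPLOn a X := by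
  obtain ⟨K, hK, hc, hU⟩ := hX
  exact ⟨K, hK, hc, hU, fun C _ => ⟨a, fun x _ => rfl⟩⟩

theorem IsPLOn.congr {F F' : (ι → ℝ) → (κ → ℝ)} {X : Set (ι → ℝ)} (h : IsPLOn F X)
    (he : EqOn F' F X) : IsPLOn F' X := by
  obtain ⟨K, hK, hc, rfl, ha⟩ := h
  refine ⟨K, hK, hc, rfl, fun C hC => ?_⟩
  obtain ⟨a, ha⟩ := ha C hC
  exact ⟨a, (he.mono (subset_sUnion_of_mem hC)).trans ha⟩

theorem IsPLOn.union {F : (ι → ℝ) → (κ → ℝ)} {X Y : Set (ι → ℝ)} (hX : IsPLOn F X)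
    (hY : IsPLOn F Y) : IsPLOn F (X ∪ Y) := by
  obtain ⟨K, hK, hc, rfl, ha⟩ := hX
  obtain ⟨K', hK', hc', rfl, ha'⟩ := hY
  refine ⟨K ∪ K', hK.union hK', ?_, sUnion_union _ _, ?_⟩
  · rintro C (h | h)
    exacts [hc C h, hc' C h]
  · rintro C (h | h)
    exacts [ha C h, ha' C h]

theorem IsPLOn.mono [Finite ι] {F : (ι → ℝ) → (κ → ℝ)} {X Y : Set (ι → ℝ)} (hX : IsPLOn F X)
    (hY : IsPolyhedron Y) (hYX : Y ⊆ X) : IsPLOn F Y := by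
  obtain ⟨K, hK, hc, rfl, ha⟩ := hX
  obtain ⟨K', hK', hc', rfl⟩ := hY
  refine ⟨image2 (· ∩ ·) K K', hK.image2 _ hK', ?_, ?_, ?_⟩
  · rintro _ ⟨C, hC, D, hD, rfl⟩
    exact (hc C hC).inter (hc' D hD)
  · ext x
    constructor
    · rintro ⟨_, ⟨C, hC, D, hD, rfl⟩, hx⟩
      exact ⟨D, hD, hx.2⟩
    · rintro ⟨D, hD, hx⟩
      obtain ⟨C, hC, hxC⟩ := hYX ⟨D, hD, hx⟩
      exact ⟨C ∩ D, ⟨C, hC, D, hD, rfl⟩, hxC, hx⟩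
  · rintro _ ⟨C, hC, D, hD, rfl⟩
    obtain ⟨a, ha⟩ := ha C hC
    exact ⟨a, ha.mono inter_subset_left⟩

theorem IsPLOn.comp [Finite ι] [Finite κ] {F : (ι → ℝ) → (κ → ℝ)} {G : (κ → ℝ) → (μ → ℝ)}
    {X : Set (ι → ℝ)} {Y : Set (κ → ℝ)} (hG : IsPLOn G Y) (hF : IsPLOn F X) (hm : MapsTo F X Y) :
    IsPLOn (G ∘ F) X := by
  obtain ⟨K, hK, hc, rfl, ha⟩ := hF
  obtain ⟨M, hM, hd, rfl, hb⟩ := hG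
  choose! a ha using ha
  choose! b hb using hb
  refine ⟨image2 (fun C D => C ∩ a C ⁻¹' D) K M, hK.image2 _ hM, ?_, ?_, ?_⟩
  · rintro _ ⟨C, hC, D, hD, rfl⟩
    exact (hc C hC).inter_preimage (hd D hD) _
  · ext x
    constructor
    · rintro ⟨_, ⟨C, hC, D, hD, rfl⟩, hx⟩
      exact ⟨C, hC, hx.1⟩
    · rintro ⟨C, hC, hx⟩
      obtain ⟨D, hD, hxD⟩ := hm ⟨C, hC, hx⟩
      refine ⟨_, ⟨C, hC, D, hD, rfl⟩, hx, ?_⟩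
      rwa [mem_preimage, ← ha C hC hx]
  · rintro _ ⟨C, hC, D, hD, rfl⟩
    refine ⟨(b D).comp (a C), fun x hx => ?_⟩
    simp only [Function.comp_apply, AffineMap.coe_comp]
    rw [ha C hC hx.1]
    exact hb D hD hx.2

theorem IsPLOn.continuousOn [Finite ι] {F : (ι → ℝ) → (κ → ℝ)} {X : Set (ι → ℝ)}
    (h : IsPLOn F X) : ContinuousOn F X := by
  obtain ⟨K, hK, hc, rfl, ha⟩ := h
  have := hK.to_subtype
  rw [sUnion_eq_iUnion]
  refine (locallyFinite_of_finite _).continuousOn_iUnion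
    (fun C => (hc C C.2).1.isClosed) fun C => ?_
  obtain ⟨a, ha⟩ := ha C C.2
  exact (continuous_affineMap a).continuousOn.congr ha

/-! ### PL homeomorphisms between subsets of the ambient spaces -/

/-- `F` and `G` restrict to mutually inverse PL homeomorphisms between `X` and `Y`. -/
structure IsPLEquivOn (F : (ι → ℝ) → (κ → ℝ)) (G : (κ → ℝ) → (ι → ℝ)) (X : Set (ι → ℝ))
    (Y : Set (κ → ℝ)) : Prop where
  mapsTo : MapsTo F X Y
  mapsTo' : MapsTo G Y X
  leftInv : LeftInvOn G F X
  rightInv : LeftInvOn F G Y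
  pl : IsPLOn F X
  pl' : IsPLOn G Y

namespace IsPLEquivOn

variable {F : (ι → ℝ) → (κ → ℝ)} {G : (κ → ℝ) → (ι → ℝ)} {X : Set (ι → ℝ)} {Y : Set (κ → ℝ)}

theorem symm (h : IsPLEquivOn F G X Y) : IsPLEquivOn G F Y X :=
  ⟨h.mapsTo', h.mapsTo, h.rightInv, h.leftInv, h.pl', h.pl⟩

theorem trans [Finite ι] [Finite κ] [Finite μ] {F' : (κ → ℝ) → (μ → ℝ)}
    {G' : (μ → ℝ) → (κ → ℝ)} {Z : Set (μ → ℝ)} (h : IsPLEquivOn F G X Y)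
    (h' : IsPLEquivOn F' G' Y Z) : IsPLEquivOn (F' ∘ F) (G ∘ G') X Z where
  mapsTo := h'.mapsTo.comp h.mapsTo
  mapsTo' := h.mapsTo'.comp h'.mapsTo'
  leftInv x hx := by
    simp only [Function.comp_apply]
    rw [h'.leftInv (h.mapsTo hx), h.leftInv hx]
  rightInv y hy := by
    simp only [Function.comp_apply]
    rw [h.rightInv (h'.mapsTo' hy), h'.rightInv hy]
  pl := h'.pl.comp h.pl h.mapsTo
  pl' := h.pl'.comp h'.pl' h'.mapsTo'

theorem restrict [Finite ι] [Finite κ] (h : IsPLEquivOn F G X Y) {X' : Set (ι → ℝ)}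
    {Y' : Set (κ → ℝ)} (hX : X' ⊆ X) (hY : Y' ⊆ Y) (hpX : IsPolyhedron X') (hpY : IsPolyhedron Y')
    (hF : MapsTo F X' Y') (hG : MapsTo G Y' X') : IsPLEquivOn F G X' Y' :=
  ⟨hF, hG, h.leftInv.mono hX, h.rightInv.mono hY, h.pl.mono hpX hX, h.pl'.mono hpY hY⟩

/-- PL homeomorphisms that agree, together with their inverses, on the overlaps can be glued. -/
theorem union {F₁ : (ι → ℝ) → (κ → ℝ)} {G₁ : (κ → ℝ) → (ι → ℝ)} {X₁ : Set (ι → ℝ)}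
    {Y₁ : Set (κ → ℝ)} (h : IsPLEquivOn F G X Y) (h₁ : IsPLEquivOn F₁ G₁ X₁ Y₁)
    (hF : EqOn F F₁ (X ∩ X₁)) (hG : EqOn G G₁ (Y ∩ Y₁)) :
    ∃ H K, IsPLEquivOn H K (X ∪ X₁) (Y ∪ Y₁) ∧ EqOn H F X ∧ EqOn H F₁ X₁ ∧ EqOn K G Y ∧
      EqOn K G₁ Y₁ := by
  classical
  have eF : EqOn (X.piecewise F F₁) F X := piecewise_eqOn _ _ _
  have eG : EqOn (Y.piecewise G G₁) G Y := piecewise_eqOn _ _ _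
  have eF₁ : EqOn (X.piecewise F F₁) F₁ X₁ := fun x hx => by
    by_cases hx' : x ∈ X
    · rw [eF hx', hF ⟨hx', hx⟩]
    · exact piecewise_eq_of_notMem _ _ _ hx'
  have eG₁ : EqOn (Y.piecewise G G₁) G₁ Y₁ := fun x hx => by
    by_cases hx' : x ∈ Y
    · rw [eG hx', hG ⟨hx', hx⟩]
    · exact piecewise_eq_of_notMem _ _ _ hx'
  refine ⟨_, _, ⟨?_, ?_, ?_, ?_, (h.pl.congr eF).union (h₁.pl.congr eF₁),
    (h.pl'.congr eG).union (h₁.pl'.congr eG₁)⟩, eF, eF₁, eG, eG₁⟩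
  · rintro x (hx | hx)
    · rw [eF hx]; exact Or.inl (h.mapsTo hx)
    · rw [eF₁ hx]; exact Or.inr (h₁.mapsTo hx)
  · rintro x (hx | hx)
    · rw [eG hx]; exact Or.inl (h.mapsTo' hx)
    · rw [eG₁ hx]; exact Or.inr (h₁.mapsTo' hx)
  · rintro x (hx | hx)
    · rw [eF hx, eG (h.mapsTo hx), h.leftInv hx]
    · rw [eF₁ hx, eG₁ (h₁.mapsTo hx), h₁.leftInv hx]
  · rintro x (hx | hx)
    · rw [eG hx, eF (h.mapsTo' hx), h.rightInv hx]
    · rw [eG₁ hx, eF₁ (h₁.mapsTo' hx), h₁.rightInv hx]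

theorem exists_homeomorph [Finite ι] [Finite κ] (h : IsPLEquivOn F G X Y) :
    ∃ g : X ≃ₜ Y, IsPLHomeo g ∧ ∀ x : X, (g x : κ → ℝ) = F x := by
  let g : X ≃ₜ Y :=
    { toFun := h.mapsTo.restrict
      invFun := h.mapsTo'.restrict
      left_inv := fun x => Subtype.ext (h.leftInv x.2)
      right_inv := fun y => Subtype.ext (h.rightInv y.2)
      continuous_toFun := h.pl.continuousOn.mapsToRestrict h.mapsTo
      continuous_invFun := h.pl'.continuousOn.mapsToRestrict h.mapsTo' }
  refine ⟨g, ⟨?_, ?_⟩, fun x => rfl⟩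
  · obtain ⟨K, hK, hc, hU, ha⟩ := h.pl
    refine ⟨K, hK, hc, hU, fun C hC => ?_⟩
    obtain ⟨a, ha⟩ := ha C hC
    exact ⟨a, fun x hx => ha hx⟩
  · obtain ⟨K, hK, hc, hU, ha⟩ := h.pl'
    refine ⟨K, hK, hc, hU, fun C hC => ?_⟩
    obtain ⟨a, ha⟩ := ha C hC
    exact ⟨a, fun x hx => ha hx⟩

end IsPLEquivOn

theorem IsPL.exists_isPLOn {X : Set (ι → ℝ)} {Y : Set (κ → ℝ)} {g : X → Y} (hg : IsPL g) :
    ∃ F : (ι → ℝ) → (κ → ℝ), IsPLOn F X ∧ ∀ x : X, F x = g x := by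
  classical
  obtain ⟨K, hK, hc, rfl, ha⟩ := hg
  let F : (ι → ℝ) → (κ → ℝ) := fun x => if hx : x ∈ ⋃₀ K then g ⟨x, hx⟩ else 0
  have hF : ∀ x : ⋃₀ K, F x = g x := fun x => dif_pos x.2
  refine ⟨F, ⟨K, hK, hc, rfl, fun C hC => ?_⟩, hF⟩
  obtain ⟨a, ha⟩ := ha C hC
  exact ⟨a, fun x hx => (hF ⟨x, C, hC, hx⟩).trans (ha _ hx)⟩

theorem IsPLHomeo.exists_isPLEquivOn {X : Set (ι → ℝ)} {Y : Set (κ → ℝ)} {g : X ≃ₜ Y}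
    (hg : IsPLHomeo g) :
    ∃ F G, IsPLEquivOn F G X Y ∧ ∀ x : X, F x = g x := by
  obtain ⟨F, hF, eF⟩ := hg.1.exists_isPLOn
  obtain ⟨G, hG, eG⟩ := hg.2.exists_isPLOn
  refine ⟨F, G, ⟨fun x hx => ?_, fun y hy => ?_, fun x hx => ?_, fun y hy => ?_, hF, hG⟩, eF⟩
  · rw [eF ⟨x, hx⟩]; exact (g _).2
  · rw [eG ⟨y, hy⟩]; exact (g.symm _).2
  · rw [eF ⟨x, hx⟩, eG]; simp
  · rw [eG ⟨y, hy⟩, eF]; simp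

end PL

/-! ### Realizations of subposets -/

section Realization

variable {P : Type*} [Fintype P]

/-- Affine inequalities cut a cell out of the standard simplex. -/
theorem isCell_stdSimplex_inter {L : Set ((P → ℝ) →ᵃ[ℝ] ℝ)} (hL : L.Finite) :
    IsCell {x : P → ℝ | x ∈ stdSimplex ℝ P ∧ ∀ l ∈ L, 0 ≤ l x} := by
  let s : (P → ℝ) →ᵃ[ℝ] ℝ := (∑ p : P, LinearMap.proj p : (P → ℝ) →ₗ[ℝ] ℝ).toAffineMap
  have hs : ∀ x, s x = ∑ p, x p := fun x => by simp [s]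
  let c : (P → ℝ) →ᵃ[ℝ] ℝ := AffineMap.const ℝ _ 1
  constructor
  · refine (isCompact_stdSimplex ℝ P).inter_right (t := {x | ∀ l ∈ L, 0 ≤ l x}) ?_
    simp only [ofPred_forall]
    exact isClosed_biInter fun l _ =>
      isClosed_le continuous_const l.continuous_of_finiteDimensional
  · refine ⟨L ∪ (range (fun p : P => (LinearMap.proj p : (P → ℝ) →ₗ[ℝ] ℝ).toAffineMap) ∪
      {s - c, c - s}), hL.union ((finite_range _).union (by simp)), ?_⟩
    ext x
    have h1 : (s - c) x = ∑ p, x p - 1 := by simp [hs, c]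
    have h2 : (c - s) x = 1 - ∑ p, x p := by simp [hs, c]
    simp only [stdSimplex, mem_ofPred_eq, mem_union, mem_range, mem_insert_iff, mem_singleton_iff,
      or_imp, forall_and, forall_eq, h1, h2, forall_exists_index, forall_apply_eq_imp_iff,
      LinearMap.coe_toAffineMap, LinearMap.proj_apply, sub_nonneg]
    constructor
    · rintro ⟨⟨h0, h1⟩, h2⟩
      exact ⟨h2, h0, h1.ge, h1.le⟩
    · rintro ⟨h2, h0, h1, h1'⟩
      exact ⟨⟨h0, le_antisymm h1' h1⟩, h2⟩

variable [PartialOrder P]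

theorem realization_mono {S T : Set P} (h : S ⊆ T) : realization S ⊆ realization T :=
  fun _ hx => ⟨hx.1, hx.2.1, hx.2.2.1.trans h, hx.2.2.2⟩

theorem realization_inter (S T : Set P) :
    realization (S ∩ T) = realization S ∩ realization T := by
  ext x
  simp only [realization, mem_ofPred_eq, subset_inter_iff, mem_inter_iff]
  tauto

/-- A chain contained in a union of two lower sets is contained in one of them. -/
theorem realization_union {S T : Set P} (hS : IsLowerSet S) (hT : IsLowerSet T) :
    realization (S ∪ T) = realization S ∪ realization T := by
  refine Subset.antisymm (fun x hx => ?_) (union_subset (realization_mono subset_union_left)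
    (realization_mono subset_union_right))
  obtain ⟨h0, h1, h2, h3⟩ := hx
  by_cases hxS : {p | x p ≠ 0} ⊆ S
  · exact Or.inl ⟨h0, h1, hxS, h3⟩
  by_cases hxT : {p | x p ≠ 0} ⊆ T
  · exact Or.inr ⟨h0, h1, hxT, h3⟩
  exfalso
  obtain ⟨a, ha, haS⟩ := not_subset.1 hxS
  obtain ⟨b, hb, hbT⟩ := not_subset.1 hxT
  have haT := (h2 ha).resolve_left haS
  have hbS := (h2 hb).resolve_right hbT
  rcases h3.total ha hb with hab | hab
  · exact haS (hS hab hbS)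
  · exact hbT (hT hab haT)

theorem realization_empty : realization (∅ : Set P) = ∅ := by
  refine eq_empty_of_forall_notMem fun x hx => ?_
  have h0 : ∀ p, x p = 0 := fun p => by_contra fun hp => hx.2.2.1 hp
  simpa [h0] using hx.2.1

/-- The support of a point of `|f⁻¹ T|` has a greatest element, whose image may serve as `q`. -/
theorem exists_mem_realization_preimage_Iic {Q : Type*} [PartialOrder Q] {f : P → Q}
    (hf : Monotone f) {T : Set Q} {x : P → ℝ} (hx : x ∈ realization (f ⁻¹' T)) :
    ∃ q ∈ T, x ∈ realization (f ⁻¹' Iic q) := by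
  obtain ⟨h0, h1, h2, h3⟩ := hx
  have hne : {p | x p ≠ 0}.Nonempty := by
    refine nonempty_iff_ne_empty.2 fun h => ?_
    have hx' : x ∈ realization (∅ : Set P) := ⟨h0, h1, h.subset, h3⟩
    rwa [realization_empty] at hx'
  obtain ⟨m, hm⟩ := (toFinite {p | x p ≠ 0}).exists_maximal hne
  refine ⟨f m, h2 hm.1, h0, h1, fun p hp => hf ?_, h3⟩
  rcases h3.total hp hm.1 with h | h
  exacts [h, hm.2 hp h]

theorem isPolyhedron_realization (S : Set P) : IsPolyhedron (realization S) := by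
  let cell : Set P → Set (P → ℝ) := fun c => {x | x ∈ stdSimplex ℝ P ∧
    ∀ l ∈ (fun p => -(LinearMap.proj p : (P → ℝ) →ₗ[ℝ] ℝ).toAffineMap) '' cᶜ, 0 ≤ l x}
  refine ⟨cell '' {c | c ⊆ S ∧ IsChain (· ≤ ·) c}, (toFinite _).image _, ?_, ?_⟩
  · rintro _ ⟨c, -, rfl⟩
    exact isCell_stdSimplex_inter ((toFinite _).image _)
  · ext x
    simp only [sUnion_image, mem_iUnion, exists_prop]
    constructor
    · rintro ⟨c, ⟨hcS, hc⟩, ⟨h0, h1⟩, h⟩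
      have hs : {p | x p ≠ 0} ⊆ c := fun p hp => by
        by_contra hpc
        have := h _ ⟨p, hpc, rfl⟩
        simp only [AffineMap.coe_neg, Pi.neg_apply, LinearMap.coe_toAffineMap,
          LinearMap.proj_apply, Left.nonneg_neg_iff] at this
        exact hp (le_antisymm this (h0 p))
      exact ⟨h0, h1, hs.trans hcS, hc.mono hs⟩
    · rintro ⟨h0, h1, h2, h3⟩
      refine ⟨_, ⟨h2, h3⟩, ⟨h0, h1⟩, ?_⟩
      rintro _ ⟨p, hp, rfl⟩
      simp only [mem_compl_iff, mem_ofPred_eq, not_not] at hp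
      simp [hp]

end Realization

/-! ### Cones -/

section Cone

variable {P P' : Type*}

/-- Restriction of the coordinates from `WithTop P` to `P`. -/
def coneRestrict : (WithTop P → ℝ) →ₗ[ℝ] (P → ℝ) := LinearMap.funLeft ℝ ℝ WithTop.some

/-- The point of `ℝ^(WithTop P)` with coordinate `t` at `⊤` and the coordinates of `y` on `P`. -/
def coneJoin (t : ℝ) (y : P → ℝ) : WithTop P → ℝ :=
  fun q => WithTop.recTopCoe (C := fun _ => ℝ) t y q

@[simp] theorem coneJoin_top (t : ℝ) (y : P → ℝ) : coneJoin t y ⊤ = t := rfl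

@[simp] theorem coneJoin_coe (t : ℝ) (y : P → ℝ) (p : P) : coneJoin t y p = y p := rfl

@[simp] theorem coneRestrict_apply (z : WithTop P → ℝ) (p : P) : coneRestrict z p = z p := rfl

@[simp] theorem coneRestrict_coneJoin (t : ℝ) (y : P → ℝ) : coneRestrict (coneJoin t y) = y := rfl

theorem coneJoin_coneRestrict (z : WithTop P → ℝ) : coneJoin (z ⊤) (coneRestrict z) = z := by
  ext q
  cases q <;> rfl

theorem toCone_eq_coneJoin (y : P → ℝ) : toCone y = coneJoin 0 y := rfl

/-- The radial extension of `F` to the cones: `((1 - t) y, t) ↦ ((1 - t) F y, t)`. At the apex,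
where `t = 1`, the factor `1 - t` makes the value of `(1 - t)⁻¹` irrelevant. -/
noncomputable def coneMap (F : (P → ℝ) → (P' → ℝ)) (z : WithTop P → ℝ) : WithTop P' → ℝ :=
  coneJoin (z ⊤) ((1 - z ⊤) • F ((1 - z ⊤)⁻¹ • coneRestrict z))

theorem coneMap_toCone (F : (P → ℝ) → (P' → ℝ)) (y : P → ℝ) :
    coneMap F (toCone y) = toCone (F y) := by
  simp [coneMap, toCone_eq_coneJoin]

theorem sum_withTop [Fintype P] (z : WithTop P → ℝ) : ∑ q, z q = z ⊤ + ∑ p : P, z p :=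
  Fintype.sum_option z

theorem coneRestrict_eq_zero [Fintype P] {z : WithTop P → ℝ} (hz : z ∈ stdSimplex ℝ (WithTop P))
    (ht : z ⊤ = 1) : coneRestrict z = 0 := by
  have h := hz.2
  rw [sum_withTop, ht, add_eq_left,
    Finset.sum_eq_zero_iff_of_nonneg fun (p : P) _ => hz.1 (p : WithTop P)] at h
  ext p
  exact h p (Finset.mem_univ p)

/-- The homogenization `((1 - t) y, t) ↦ (1 - t) a y` of an affine map `a`, as an affine map defined
also at the apex. -/
noncomputable def homogenize {E : Type*} [AddCommGroup E] [Module ℝ E]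
    (a : (P → ℝ) →ᵃ[ℝ] E) : (WithTop P → ℝ) →ᵃ[ℝ] E :=
  (a.linear ∘ₗ coneRestrict).toAffineMap + (LinearMap.toSpanSingleton ℝ E (a 0)).toAffineMap.comp
    (AffineMap.const ℝ _ 1 - (LinearMap.proj ⊤ : (WithTop P → ℝ) →ₗ[ℝ] ℝ).toAffineMap)

theorem homogenize_apply {E : Type*} [AddCommGroup E] [Module ℝ E] (a : (P → ℝ) →ᵃ[ℝ] E)
    (z : WithTop P → ℝ) :
    homogenize a z = a.linear (coneRestrict z) + (1 - z ⊤) • a 0 := by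
  simp [homogenize, sub_smul]

/-- Also at the apex the homogenization has the value suggested by the formula, as `1 - t = 0`. -/
theorem homogenize_eq {E : Type*} [AddCommGroup E] [Module ℝ E] [Fintype P]
    (a : (P → ℝ) →ᵃ[ℝ] E) {z : WithTop P → ℝ} (hz : z ∈ stdSimplex ℝ (WithTop P)) :
    homogenize a z = (1 - z ⊤) • a ((1 - z ⊤)⁻¹ • coneRestrict z) := by
  rw [homogenize_apply]
  by_cases hne : z ⊤ = 1
  · simp [hne, coneRestrict_eq_zero hz hne]
  · have hne' : 1 - z ⊤ ≠ 0 := sub_ne_zero.2 (Ne.symm hne)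
    have ha : ∀ y, a y = a.linear y + a 0 := fun y => congrFun (AffineMap.decomp a) y
    rw [ha (_ • _), map_smul, smul_add, smul_inv_smul₀ hne']

/-- The cone over a subset `C` of the standard simplex, in join coordinates. -/
def coneCell [Fintype P] (C : Set (P → ℝ)) : Set (WithTop P → ℝ) :=
  {z | z ∈ stdSimplex ℝ (WithTop P) ∧ (z ⊤ ≠ 1 → (1 - z ⊤)⁻¹ • coneRestrict z ∈ C)}

theorem IsCell.coneCell [Fintype P] {C : Set (P → ℝ)} (hC : IsCell C) : IsCell (coneCell C) := by
  obtain ⟨-, L, hL, rfl⟩ := hC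
  convert isCell_stdSimplex_inter (hL.image homogenize) using 1
  ext z
  refine and_congr_right fun hz => ?_
  have ht : z ⊤ ≤ 1 := (mem_Icc_of_mem_stdSimplex hz ⊤).2
  simp only [forall_mem_image, mem_ofPred_eq, homogenize_eq _ hz, smul_eq_mul]
  by_cases hne : z ⊤ = 1
  · simp [hne]
  · have hpos : 0 < 1 - z ⊤ := sub_pos.2 (lt_of_le_of_ne ht hne)
    simp [hne, mul_nonneg_iff_of_pos_left hpos]

variable [Fintype P] [PartialOrder P]

/-- Join coordinates on the cone: away from the apex its points are `((1 - t) y, t)` with `y` in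
the base. -/
theorem mem_realization_cone_iff {Q : Set P} {z : WithTop P → ℝ}
    (hz : z ∈ stdSimplex ℝ (WithTop P)) :
    z ∈ realization (cone Q) ↔
      (z ⊤ ≠ 1 → (1 - z ⊤)⁻¹ • coneRestrict z ∈ realization Q) := by
  have ht : z ⊤ ≤ 1 := (mem_Icc_of_mem_stdSimplex hz ⊤).2
  constructor
  · rintro ⟨h0, h1, h2, h3⟩ hne
    have hpos : 0 < 1 - z ⊤ := sub_pos.2 (lt_of_le_of_ne ht hne)
    refine ⟨fun p => mul_nonneg (inv_nonneg.2 hpos.le) (h0 p), ?_, fun p hp => ?_, ?_⟩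
    · rw [sum_withTop] at h1
      simp only [Pi.smul_apply, coneRestrict_apply, smul_eq_mul, ← Finset.mul_sum]
      rw [← eq_sub_iff_add_eq'] at h1
      rw [h1, inv_mul_cancel₀ hpos.ne']
    · have hp' : z p ≠ 0 := fun h => hp (by simp [h])
      simpa [cone] using h2 hp'
    · intro p hp q hq hpq
      have hp' : z p ≠ 0 := fun h => hp (by simp [h])
      have hq' : z q ≠ 0 := fun h => hq (by simp [h])
      simpa using h3 hp' hq' (by simpa using hpq)
  · intro h
    refine ⟨hz.1, hz.2, ?_⟩
    have key : {p : P | z p ≠ 0} ⊆ Q ∧ IsChain (· ≤ ·) {p : P | z p ≠ 0} := by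
      by_cases hne : z ⊤ = 1
      · have h0 : ∀ p : P, z p = 0 := congrFun (coneRestrict_eq_zero hz hne)
        simp [h0]
      · have he : {p : P | z p ≠ 0} =
            {p : P | ((1 - z ⊤)⁻¹ • coneRestrict z) p ≠ 0} := by
          ext p
          simp [sub_eq_zero, Ne.symm hne]
        rw [he]
        exact (h hne).2.2
    constructor
    · intro q hq
      cases q with
      | top => exact mem_insert _ _
      | coe p => exact mem_insert_of_mem _ ⟨p, key.1 hq, rfl⟩
    · intro a ha b hb hab
      cases a with
      | top => exact Or.inr le_top
      | coe a =>
        cases b with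
        | top => exact Or.inl le_top
        | coe b => simpa using key.2 ha hb (by simpa using hab)

theorem leftInvOn_coneMap {F : (P → ℝ) → (P' → ℝ)} {G : (P' → ℝ) → (P → ℝ)} {Q : Set P}
    (h : LeftInvOn G F (realization Q)) :
    LeftInvOn (coneMap G) (coneMap F) (realization (cone Q)) := by
  intro z hz
  have hs : z ∈ stdSimplex ℝ (WithTop P) := ⟨hz.1, hz.2.1⟩
  have hz' := (mem_realization_cone_iff hs).1 hz
  conv_rhs => rw [← coneJoin_coneRestrict z]
  by_cases hne : z ⊤ = 1
  · simp [coneMap, hne, coneRestrict_eq_zero hs hne]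
  · have hne' : 1 - z ⊤ ≠ 0 := sub_ne_zero.2 (Ne.symm hne)
    have := h (hz' hne)
    simp [coneMap, smul_smul, hne', this]

theorem IsPLOn.coneMap {F : (P → ℝ) → (P' → ℝ)} {Q : Set P} (hF : IsPLOn F (realization Q)) :
    IsPLOn (coneMap F) (realization (cone Q)) := by
  obtain ⟨K, hK, hc, hU, ha⟩ := hF
  -- The empty cell is added because its cone is the apex, which is all of the cone over `∅`.
  have hc' : ∀ C ∈ insert ∅ K, IsCell C := by
    rintro C (rfl | hC)
    · exact ⟨isCompact_empty, {AffineMap.const ℝ _ (-1)}, finite_singleton _, by ext; simp⟩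
    · exact hc C hC
  have ha' : ∀ C ∈ insert ∅ K, ∃ a : (P → ℝ) →ᵃ[ℝ] (P' → ℝ), EqOn F a C := by
    rintro C (rfl | hC)
    · exact ⟨AffineMap.const ℝ _ 0, eqOn_empty _ _⟩
    · exact ha C hC
  refine ⟨coneCell '' insert ∅ K, (hK.insert ∅).image _, ?_, ?_, ?_⟩
  · rintro _ ⟨C, hC, rfl⟩
    exact (hc' C hC).coneCell
  · ext z
    simp only [sUnion_image, mem_iUnion, exists_prop]
    constructor
    · rintro ⟨C, hC, hz, h⟩
      refine (mem_realization_cone_iff hz).2 fun hne => ?_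
      rcases hC with rfl | hC
      · exact (h hne).elim
      · exact hU ▸ ⟨C, hC, h hne⟩
    · intro hz
      have hs : z ∈ stdSimplex ℝ (WithTop P) := ⟨hz.1, hz.2.1⟩
      have hz' := (mem_realization_cone_iff hs).1 hz
      by_cases hne : z ⊤ = 1
      · exact ⟨∅, mem_insert _ _, hs, fun h => (h hne).elim⟩
      · obtain ⟨C, hC, hzC⟩ := hU.symm ▸ hz' hne
        exact ⟨C, mem_insert_of_mem _ hC, hs, fun _ => hzC⟩
  · rintro _ ⟨C, hC, rfl⟩
    obtain ⟨a, ha⟩ := ha' C hC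
    refine ⟨AffineMap.pi fun q => WithTop.recTopCoe
      (C := fun _ => (WithTop P → ℝ) →ᵃ[ℝ] ℝ) (LinearMap.proj ⊤ : _ →ₗ[ℝ] ℝ).toAffineMap
      (fun p => (LinearMap.proj p : _ →ₗ[ℝ] ℝ).toAffineMap.comp (homogenize a)) q, ?_⟩
    rintro z ⟨hz, h⟩
    ext q
    cases q with
    | top => rfl
    | coe p =>
      change ((1 - z ⊤) • F ((1 - z ⊤)⁻¹ • coneRestrict z)) p = homogenize a z p
      rw [homogenize_eq a hz]
      by_cases hne : z ⊤ = 1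
      · simp [hne]
      · rw [ha (h hne)]

variable [Fintype P'] [PartialOrder P']

theorem mapsTo_coneMap {F : (P → ℝ) → (P' → ℝ)} {Q : Set P} {Q' : Set P'}
    (hF : MapsTo F (realization Q) (realization Q')) :
    MapsTo (coneMap F) (realization (cone Q)) (realization (cone Q')) := by
  intro z hz
  have hs : z ∈ stdSimplex ℝ (WithTop P) := ⟨hz.1, hz.2.1⟩
  have ht : z ⊤ ≤ 1 := (mem_Icc_of_mem_stdSimplex hs ⊤).2
  have hz' := (mem_realization_cone_iff hs).1 hz
  have hs' : coneMap F z ∈ stdSimplex ℝ (WithTop P') := by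
    by_cases hne : z ⊤ = 1
    · refine ⟨fun q => ?_, by simp [sum_withTop, coneMap, hne]⟩
      cases q with
      | top => exact hz.1 ⊤
      | coe p => simp [coneMap, hne]
    · have hF' := hF (hz' hne)
      refine ⟨fun q => ?_, ?_⟩
      · cases q with
        | top => exact hz.1 ⊤
        | coe p => exact mul_nonneg (sub_nonneg.2 ht) (hF'.1 p)
      · simp [sum_withTop, coneMap, ← Finset.mul_sum, hF'.2.1]
  refine (mem_realization_cone_iff hs').2 fun hne => ?_
  have hne' : 1 - z ⊤ ≠ 0 := sub_ne_zero.2 (Ne.symm hne)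
  simpa [coneMap, smul_smul, hne'] using hF (hz' hne)

theorem IsPLEquivOn.cone {F : (P → ℝ) → (P' → ℝ)} {G : (P' → ℝ) → (P → ℝ)} {Q : Set P}
    {Q' : Set P'} (h : IsPLEquivOn F G (realization Q) (realization Q')) :
    IsPLEquivOn (coneMap F) (coneMap G) (realization (cone Q)) (realization (cone Q')) :=
  ⟨mapsTo_coneMap h.mapsTo, mapsTo_coneMap h.mapsTo', leftInvOn_coneMap h.leftInv,
    leftInvOn_coneMap h.rightInv, h.pl.coneMap, h.pl'.coneMap⟩

end Cone

/-! ### Principal lower sets as cones -/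

section Principal

variable {P : Type*}

open Classical in
/-- Renaming of the coordinate at `p` to `⊤`. -/
noncomputable def toConeAt (p : P) : (P → ℝ) →ₗ[ℝ] (WithTop P → ℝ) :=
  LinearMap.pi fun q => WithTop.recTopCoe (C := fun _ => (P → ℝ) →ₗ[ℝ] ℝ) (LinearMap.proj p)
    (fun q => if q = p then 0 else LinearMap.proj q) q

open Classical in
/-- Renaming of the coordinate at `⊤` to `p`. -/
noncomputable def ofConeAt (p : P) : (WithTop P → ℝ) →ₗ[ℝ] (P → ℝ) :=
  LinearMap.pi fun q => if q = p then LinearMap.proj ⊤ else LinearMap.proj (q : WithTop P)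

@[simp] theorem toConeAt_top (p : P) (x : P → ℝ) : toConeAt p x ⊤ = x p := rfl

open Classical in
@[simp] theorem toConeAt_coe (p : P) (x : P → ℝ) (q : P) :
    toConeAt p x q = if q = p then 0 else x q := by
  change (if q = p then 0 else LinearMap.proj q : (P → ℝ) →ₗ[ℝ] ℝ) x = _
  split_ifs <;> rfl

open Classical in
@[simp] theorem ofConeAt_apply (p : P) (z : WithTop P → ℝ) (q : P) :
    ofConeAt p z q = if q = p then z ⊤ else z q := by
  change (if q = p then LinearMap.proj ⊤ else LinearMap.proj (q : WithTop P) :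
    (WithTop P → ℝ) →ₗ[ℝ] ℝ) z = _
  split_ifs <;> rfl

variable [Fintype P] [PartialOrder P]

theorem toConeAt_eq_toCone {p : P} {x : P → ℝ} (hx : x ∈ realization (Iio p)) :
    toConeAt p x = toCone x := by
  have hp : x p = 0 := by
    by_contra h
    exact lt_irrefl p (hx.2.2.1 h)
  ext q
  cases q with
  | top => exact hp
  | coe q =>
    rw [toConeAt_coe, toCone_eq_coneJoin, coneJoin_coe]
    split_ifs with h
    exacts [by rw [h, hp], rfl]

/-- The realization of `Iic p` is the cone over the realization of `Iio p`. -/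
theorem isPLEquivOn_toConeAt (p : P) :
    IsPLEquivOn (toConeAt p) (ofConeAt p) (realization (Iic p)) (realization (cone (Iio p))) where
  mapsTo x hx := by
    classical
    obtain ⟨h0, h1, h2, h3⟩ := hx
    have hsupp : ∀ {q : P}, toConeAt p x q ≠ 0 → x q ≠ 0 ∧ q < p := fun {q} hq => by
      rw [toConeAt_coe] at hq
      have hqp : q ≠ p := fun h => hq (if_pos h)
      rw [if_neg hqp] at hq
      exact ⟨hq, lt_of_le_of_ne (h2 hq) hqp⟩
    refine ⟨fun q => ?_, ?_, fun q hq => ?_, fun a ha b hb hab => ?_⟩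
    · cases q with
      | top => exact h0 p
      | coe q =>
        rw [toConeAt_coe]
        split_ifs
        exacts [le_rfl, h0 q]
    · rw [sum_withTop, ← h1, ← Finset.add_sum_erase _ _ (Finset.mem_univ p), toConeAt_top,
        ← Finset.add_sum_erase _ x (Finset.mem_univ p)]
      simp only [toConeAt_coe, if_true, zero_add]
      congr 1
      exact Finset.sum_congr rfl fun q hq => if_neg (Finset.ne_of_mem_erase hq)
    · cases q with
      | top => exact mem_insert _ _
      | coe q => exact mem_insert_of_mem _ ⟨q, (hsupp hq).2, rfl⟩
    · cases a with
      | top => exact Or.inr le_top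
      | coe a =>
        cases b with
        | top => exact Or.inl le_top
        | coe b => simpa using h3 (hsupp ha).1 (hsupp hb).1 (by simpa using hab)
  mapsTo' z hz := by
    classical
    obtain ⟨h0, h1, h2, h3⟩ := hz
    have hlt : ∀ {q : P}, z q ≠ 0 → q < p := fun {q} hq => by simpa [cone] using h2 hq
    have hzp : z p = 0 := by
      by_contra h
      exact lt_irrefl p (hlt h)
    have hsupp : ∀ {q : P}, ofConeAt p z q ≠ 0 → q = p ∨ q < p ∧ z q ≠ 0 := fun {q} hq => by
      by_cases hqp : q = p
      · exact Or.inl hqp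
      · rw [ofConeAt_apply, if_neg hqp] at hq
        exact Or.inr ⟨hlt hq, hq⟩
    refine ⟨fun q => ?_, ?_, fun q hq => ?_, fun a ha b hb hab => ?_⟩
    · rw [ofConeAt_apply]
      split_ifs
      exacts [h0 _, h0 _]
    · rw [← h1, sum_withTop, ← Finset.add_sum_erase _ _ (Finset.mem_univ p),
        ← Finset.add_sum_erase _ (fun q : P => z q) (Finset.mem_univ p)]
      simp only [ofConeAt_apply, if_true, hzp, zero_add]
      congr 1
      exact Finset.sum_congr rfl fun q hq => if_neg (Finset.ne_of_mem_erase hq)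
    · rcases hsupp hq with rfl | h
      exacts [le_rfl, h.1.le]
    · rcases hsupp ha with rfl | ⟨hap, ha⟩
      · rcases hsupp hb with rfl | ⟨hbp, -⟩
        exacts [(hab rfl).elim, Or.inr hbp.le]
      · rcases hsupp hb with rfl | ⟨-, hb⟩
        · exact Or.inl hap.le
        · simpa using h3 ha hb (by simpa using hab)
  leftInv x _ := by
    ext q
    by_cases h : q = p <;> simp [h]
  rightInv z hz := by
    have hzp : z p = 0 := by
      by_contra h
      have : p < p := by simpa [cone] using hz.2.2.1 h
      exact lt_irrefl p this
    ext q
    cases q with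
    | top => simp
    | coe q => by_cases h : q = p <;> simp [h, hzp]
  pl := (isPolyhedron_realization _).isPLOn_affine (toConeAt p).toAffineMap
  pl' := (isPolyhedron_realization _).isPLOn_affine (ofConeAt p).toAffineMap

end Principal

/-! ### Subdivision maps -/

section Subdivision

variable {P P' : Type*} [Fintype P] [PartialOrder P] [Fintype P'] [PartialOrder P'] {f : P' → P}

/-- A PL homeomorphism that respects the subcomplexes over principal lower sets makes `f` a
subdivision map. -/
theorem isSubdivisionMap_of_isPLEquivOn (hf : Monotone f) {F : (P' → ℝ) → (P → ℝ)}
    {G : (P → ℝ) → (P' → ℝ)} (h : IsPLEquivOn F G (realization univ) (realization univ))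
    (hp : ∀ p, ∀ x ∈ realization (univ : Set P'),
      F x ∈ realization (Iic p) ↔ x ∈ realization (f ⁻¹' Iic p)) :
    IsSubdivisionMap f := by
  refine ⟨hf, fun p => ?_⟩
  have key : ∀ T : Set P, IsLowerSet T →
      IsPLEquivOn F G (realization (f ⁻¹' T)) (realization T) := by
    intro T hT
    refine h.restrict (realization_mono (subset_univ _)) (realization_mono (subset_univ _))
      (isPolyhedron_realization _) (isPolyhedron_realization _) (fun x hx => ?_) fun y hy => ?_
    · obtain ⟨q, hq, hx⟩ := exists_mem_realization_preimage_Iic hf hx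
      exact realization_mono (hT.Iic_subset hq)
        ((hp q x (realization_mono (subset_univ _) hx)).2 hx)
    · obtain ⟨q, hq, hyq⟩ := exists_mem_realization_preimage_Iic (f := id) monotone_id hy
      have hy' : y ∈ realization univ := realization_mono (subset_univ _) hy
      refine realization_mono (preimage_mono (hT.Iic_subset hq))
        ((hp q (G y) (h.mapsTo' hy')).1 ?_)
      rwa [h.rightInv hy']
  have hIio := key (Iio p) (isLowerSet_Iio p)
  obtain ⟨g, hg, hgx⟩ := (((key (Iic p) (isLowerSet_Iic p)).trans
    (isPLEquivOn_toConeAt p)).trans hIio.symm.cone).exists_homeomorph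
  refine ⟨g, hg, fun x hx => ?_⟩
  rw [hgx]
  simp only [Function.comp_apply]
  rw [toConeAt_eq_toCone (hIio.mapsTo hx), coneMap_toCone, hIio.leftInv hx]

/-- The inductive construction of the homeomorphism, over larger and larger lower sets `S`. The
inductive step needs that it respects the subcomplexes over all lower subsets of `S`, in both
directions. -/
theorem exists_isPLEquivOn_of_isLowerSet (hf : IsSubdivisionMap f) (S : Finset P)
    (hS : IsLowerSet (S : Set P)) :
    ∃ F G, IsPLEquivOn F G (realization (f ⁻¹' S)) (realization (S : Set P)) ∧
      ∀ T ⊆ (S : Set P), IsLowerSet T → MapsTo F (realization (f ⁻¹' T)) (realization T) ∧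
        MapsTo G (realization T) (realization (f ⁻¹' T)) := by
  classical
  induction hn : S.card generalizing S with
  | zero =>
    obtain rfl := Finset.card_eq_zero.1 hn
    rw [Finset.coe_empty, preimage_empty, realization_empty, realization_empty]
    refine ⟨0, 0, ⟨mapsTo_empty _ _, mapsTo_empty _ _, fun x hx => hx.elim, fun x hx => hx.elim,
      ⟨∅, finite_empty, by simp, sUnion_empty, by simp⟩,
      ⟨∅, finite_empty, by simp, sUnion_empty, by simp⟩⟩, fun T hT _ => ?_⟩
    obtain rfl := subset_empty_iff.1 hT
    rw [preimage_empty, realization_empty, realization_empty]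
    exact ⟨mapsTo_empty _ _, mapsTo_empty _ _⟩
  | succ n ih =>
    -- A maximal element of `S` is removed, so that `Iic p` meets the rest in exactly `Iio p`.
    obtain ⟨p, hp⟩ := S.exists_maximal (Finset.card_pos.1 (by omega))
    obtain ⟨S₀, hS₀⟩ : ∃ S₀, S₀ = S.erase p := ⟨_, rfl⟩
    have hlow : IsLowerSet (S₀ : Set P) := by
      subst hS₀
      intro a b hba ha
      rw [Finset.mem_coe, Finset.mem_erase] at ha ⊢
      refine ⟨?_, hS hba ha.2⟩
      rintro rfl
      exact ha.1 (le_antisymm (hp.2 ha.2 hba) hba)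
    have hunion : (S : Set P) = (S₀ : Set P) ∪ Iic p := by
      subst hS₀
      ext q
      by_cases hq : q = p
      · simp [hq, hp.1]
      · simp only [Finset.coe_erase, mem_union, mem_sdiff, mem_singleton_iff, hq, not_false_eq_true,
          and_true, mem_Iic]
        exact ⟨Or.inl, fun h => h.elim id fun h => hS h hp.1⟩
    have hinter : (S₀ : Set P) ∩ Iic p = Iio p := by
      subst hS₀
      ext q
      simp only [Finset.coe_erase, mem_inter_iff, mem_sdiff, mem_singleton_iff, mem_Iic, mem_Iio]
      exact ⟨fun h => lt_of_le_of_ne h.2 h.1.2, fun h => ⟨⟨hS h.le hp.1, h.ne⟩, h.le⟩⟩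
    obtain ⟨F, G, hFG, hT⟩ := ih S₀ hlow (by rw [hS₀, Finset.card_erase_of_mem hp.1]; omega)
    obtain ⟨g, hg, hgx⟩ := hf.2 p
    obtain ⟨E, E', hE, hEg⟩ := hg.exists_isPLEquivOn
    have hEx : ∀ x ∈ realization (f ⁻¹' Iio p), E x = toCone x := fun x hx => by
      have hx' : x ∈ realization (f ⁻¹' Iic p) :=
        realization_mono (preimage_mono Iio_subset_Iic_self) hx
      exact (hEg ⟨x, hx'⟩).trans (hgx ⟨x, hx'⟩ hx)
    have hIio : IsPLEquivOn F G (realization (f ⁻¹' Iio p)) (realization (Iio p)) := by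
      have hsub : Iio p ⊆ (S₀ : Set P) := hinter ▸ inter_subset_left
      obtain ⟨h1, h2⟩ := hT _ hsub (isLowerSet_Iio p)
      exact hFG.restrict (realization_mono (preimage_mono hsub)) (realization_mono hsub)
        (isPolyhedron_realization _) (isPolyhedron_realization _) h1 h2
    have hIic := (hE.trans hIio.cone).trans (isPLEquivOn_toConeAt p).symm
    have hFeq : EqOn F (ofConeAt p ∘ coneMap F ∘ E)
        (realization (f ⁻¹' S₀) ∩ realization (f ⁻¹' Iic p)) := by
      intro x hx
      rw [← realization_inter, ← preimage_inter, hinter] at hx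
      have hFx := hIio.mapsTo hx
      simp only [Function.comp_apply]
      rw [hEx x hx, coneMap_toCone, ← toConeAt_eq_toCone hFx,
        (isPLEquivOn_toConeAt p).leftInv (realization_mono Iio_subset_Iic_self hFx)]
    have hGeq : EqOn G ((E' ∘ coneMap G) ∘ toConeAt p)
        (realization (S₀ : Set P) ∩ realization (Iic p)) := by
      intro y hy
      rw [← realization_inter, hinter] at hy
      have hGy := hIio.mapsTo' hy
      simp only [Function.comp_apply]
      rw [toConeAt_eq_toCone hy, coneMap_toCone, ← hEx _ hGy,
        hE.leftInv (realization_mono (preimage_mono Iio_subset_Iic_self) hGy)]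
    obtain ⟨H, K, hH, hHF, hHF₁, hKG, hKG₁⟩ := hFG.union hIic hFeq hGeq
    have hX : ∀ A : Set P, IsLowerSet A → realization (f ⁻¹' (A ∪ Iic p)) =
        realization (f ⁻¹' A) ∪ realization (f ⁻¹' Iic p) := fun A hA => by
      rw [preimage_union, realization_union (hA.preimage hf.1) ((isLowerSet_Iic p).preimage hf.1)]
    rw [← hX _ hlow, ← realization_union hlow (isLowerSet_Iic p), ← hunion] at hH
    refine ⟨H, K, hH, fun T hTS hTl => ?_⟩
    have hold : ∀ A ⊆ (S₀ : Set P), IsLowerSet A →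
        MapsTo H (realization (f ⁻¹' A)) (realization A) ∧
          MapsTo K (realization A) (realization (f ⁻¹' A)) := fun A hA hAl =>
      ⟨(hT A hA hAl).1.congr (hHF.symm.mono (realization_mono (preimage_mono hA))),
        (hT A hA hAl).2.congr (hKG.symm.mono (realization_mono hA))⟩
    by_cases hpT : p ∈ T
    · have hTeq : T = (T ∩ S₀) ∪ Iic p := by
        rw [inter_union_distrib_right, union_eq_self_of_subset_right (hTl.Iic_subset hpT), ← hunion,
          inter_eq_self_of_subset_left hTS]
      obtain ⟨h1, h2⟩ := hold (T ∩ S₀) inter_subset_right (hTl.inter hlow)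
      rw [hTeq, hX _ (hTl.inter hlow), realization_union (hTl.inter hlow) (isLowerSet_Iic p)]
      exact ⟨h1.union_union (hIic.mapsTo.congr hHF₁.symm),
        h2.union_union (hIic.mapsTo'.congr hKG₁.symm)⟩
    · refine hold T (fun q hq => ?_) hTl
      rw [hS₀, Finset.mem_coe, Finset.mem_erase]
      exact ⟨fun h => hpT (h ▸ hq), hTS hq⟩

end Subdivision

end PLPoset

theorem mainTheorem7 {P' P : Type*} [Fintype P'] [PartialOrder P'] [Fintype P] [PartialOrder P]
    (f : P' → P) (hf : Monotone f) :
    PLPoset.IsSubdivisionMap f ↔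
      ∃ h : PLPoset.realization (Set.univ : Set P') ≃ₜ PLPoset.realization (Set.univ : Set P),
        PLPoset.IsPLHomeo h ∧
          ∀ p : P,
            h ⁻¹' (Subtype.val ⁻¹' PLPoset.realization (Set.Iic p)) =
              Subtype.val ⁻¹' PLPoset.realization (f ⁻¹' Set.Iic p) := by
  constructor
  · intro h
    obtain ⟨F, G, hFG, hT⟩ := PLPoset.exists_isPLEquivOn_of_isLowerSet h Finset.univ
      (by simpa using isLowerSet_univ)
    rw [Finset.coe_univ, Set.preimage_univ] at hFG
    obtain ⟨g, hg, hgx⟩ := hFG.exists_homeomorph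
    refine ⟨g, hg, fun p => ?_⟩
    obtain ⟨h1, h2⟩ := hT (Set.Iic p) (by simp) (isLowerSet_Iic p)
    ext x
    rw [Set.mem_preimage, Set.mem_preimage, Set.mem_preimage, hgx]
    refine ⟨fun hx => ?_, fun hx => h1 hx⟩
    rw [← hFG.leftInv x.2]
    exact h2 hx
  · rintro ⟨h, hh, hp⟩
    obtain ⟨F, G, hFG, hF⟩ := hh.exists_isPLEquivOn
    refine PLPoset.isSubdivisionMap_of_isPLEquivOn hf hFG fun p x hx => ?_
    rw [hF ⟨x, hx⟩]
    exact Set.ext_iff.1 (hp p) ⟨x, hx⟩
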